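/- Let $\tau(n)$ be the Ramanujan function, defined by $X\prod_{n=1}^{\infty}(1-X^n)^{24}=\sum_{n=1}^{\infty}\tau(n)X^n$. There exist an absolute constant $C>0$ and an integer $p_0$ such that for every prime $p\ge p_0$ the following holds. (i) For every integer $\lambda$ there are positive integers $n_1,\dots,n_{96}$ with $\max_{1\le i\le 96} n_i\le C\,p^2\log^4 p$ and $$\sum_{i=1}^{96}\tau(n_i)\equiv\lambda\pmod p.$$ (ii) Consequently, the set $\{\tau(n)\bmod p:\ n\ge 1,\ n\le C\,p^2\log^4 p\}$ is a finite additive basis of $\mathbb{Z}_p$ of order at most $96$; that is, the least integer $h\ge 1$ such that every element of $\mathbb{Z}_p$ is a sum of $h$ (not necessarily distinct) elements of this set exists and satisfies $h\le 96$. -/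

import Mathlib

open scoped PowerSeries.WithPiTopology in
/-- The formal power series `X ∏_{n ≥ 1} (1 - Xⁿ)²⁴` with integer coefficients. The infinite product
is taken in the topology of coefficientwise convergence (`ℤ` being discrete); the index `n : ℕ`
is shifted by one. -/
noncomputable def ramanujanSeries : PowerSeries ℤ :=
  PowerSeries.X * ∏' n : ℕ, (1 - (PowerSeries.X : PowerSeries ℤ) ^ (n + 1)) ^ 24

open scoped PowerSeries.WithPiTopology in
/-- The infinite product in `ramanujanSeries` converges. -/
theorem multipliable_ramanujanSeries :
    Multipliable fun n : ℕ => (1 - (PowerSeries.X : PowerSeries ℤ) ^ (n + 1)) ^ 24 :=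
  (PowerSeries.WithPiTopology.multipliable_one_sub_X_pow ℤ).pow 24

/-- The Ramanujan function `τ(n)`: the coefficient of `Xⁿ` in `X ∏_{n ≥ 1} (1 - Xⁿ)²⁴`. -/
noncomputable def ramanujanTau (n : ℕ) : ℤ :=
  PowerSeries.coeff n ramanujanSeries

/-- Every element of `G` is a sum of exactly `k` elements of `A`, repetitions allowed. -/
def IsAdditiveBasisWith {G : Type*} [AddCommMonoid G] (A : Set G) (k : ℕ) : Prop :=
  ∀ x : G, ∃ a : Fin k → G, (∀ i, a i ∈ A) ∧ ∑ i, a i = x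

/-- `A` is a finite additive basis of `G` of order `h`: the number `h` is the least positive
integer `k` such that every element of `G` is a sum of `k` elements of `A`. -/
def IsAdditiveBasisOfOrder {G : Type*} [AddCommMonoid G] (A : Set G) (h : ℕ) : Prop :=
  IsLeast {k : ℕ | 0 < k ∧ IsAdditiveBasisWith A k} h

/-- The set `{τ(n) mod p : n positive, n ≤ x}` of residues modulo `p`. -/
def tauResidues (p : ℕ) (x : ℝ) : Set (ZMod p) :=
  {a | ∃ n : ℕ, 0 < n ∧ (n : ℝ) ≤ x ∧ (ramanujanTau n : ZMod p) = a}

/-! Put `y` about `√p log p`, so that the primes up to `y` number at least a large constant times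
`√p`. Split those above 23 into disjoint sets `Q₁`, `Q₂` with `#Q₁ * #Q₂ > 22² p`. Each set yields a
positive proportion of `#Qᵢ` residues of the form `τ(m) - τ(m')`, with `m`, `m' ≤ y²` supported on
that set (`exists_many_differences`): either `τ` takes many values on the primes, or many primes `q`
share their value with another prime `r`, and then `τ(qr) - τ(q²) = q¹¹`. If `A`, `B` are the
resulting sets, then `#A * #B > p`, and a sum-product argument (`exists_eq_sum_products`) writes
every residue as four products minus four products from `A * B`. By multiplicativity each product is
a sum of two values of `τ` minus two others, at integers up to `y⁴`, so every residue is sixteen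
values minus sixteen (`exists_eq_sub_sixteen`).

The signs are removed by the relation `-τ(12) = τ(27) + τ(55) + τ(69) + τ(90) + τ(105)`. Multiplying
the representation of `x / τ(12)` by `τ(12)` turns each positive term into one value of `τ` and each
negative term into five: `16 + 80 = 96` in all. The largest index is at most `105 y⁴`, of order `p²
log⁴ p`.

The arithmetic of `τ` comes from Mordell's theorem (`heckeCoeff_eq`): `T_q Δ` is a cusp form of
weight 12, hence a multiple of `Δ`. -/

/-! ### The q-expansion of the discriminant form -/

section QExpansion

open Filter Topology

/-- The value at `q` of the power series `f` with integer coefficients is `s`. -/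
def HasValue (f : PowerSeries ℤ) (q s : ℂ) : Prop :=
  HasSum (fun n => ((PowerSeries.coeff n f : ℤ) : ℂ) * q ^ n) s

lemma HasValue.mul {f g : PowerSeries ℤ} {q s t : ℂ} (hf : HasValue f q s) (hg : HasValue g q t) :
    HasValue (f * g) q (s * t) := by
  have hf' := hf.summable.norm
  have hg' := hg.summable.norm
  have h := (summable_norm_sum_mul_antidiagonal_of_summable_norm hf' hg').of_norm.hasSum
  rw [← tsum_mul_tsum_eq_tsum_sum_antidiagonal_of_summable_norm hf' hg', hf.tsum_eq,
    hg.tsum_eq] at h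
  rw [HasValue]
  refine (congrArg (HasSum · (s * t)) (funext fun n => ?_)).mpr h
  rw [PowerSeries.coeff_mul]
  push_cast
  rw [Finset.sum_mul]
  refine Finset.sum_congr rfl fun x hx => ?_
  rw [← Finset.HasAntidiagonal.mem_antidiagonal.mp hx, pow_add]
  ring

lemma hasValue_one (q : ℂ) : HasValue 1 q 1 := by
  have := hasSum_single
    (f := fun n => ((PowerSeries.coeff n (1 : PowerSeries ℤ) : ℤ) : ℂ) * q ^ n) 0
    (fun n hn => by simp [PowerSeries.coeff_one, hn])
  simpa [HasValue] using this

lemma hasValue_X (q : ℂ) : HasValue PowerSeries.X q q := by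
  have := hasSum_single
    (f := fun n => ((PowerSeries.coeff n (PowerSeries.X : PowerSeries ℤ) : ℤ) : ℂ) * q ^ n) 1
    (fun n hn => by simp [PowerSeries.coeff_X, hn])
  simpa [HasValue] using this

lemma HasValue.pow {f : PowerSeries ℤ} {q s : ℂ} (hf : HasValue f q s) (n : ℕ) :
    HasValue (f ^ n) q (s ^ n) := by
  induction n with
  | zero => simpa using hasValue_one q
  | succ n ih => simpa [pow_succ] using ih.mul hf

/-- Weierstrass's theorem, iterated; holomorphy is carried through the induction because each
differentiation needs it. -/
lemma tendstoLocallyUniformlyOn_iteratedDeriv {ι : Type*} {φ : Filter ι} {F : ι → ℂ → ℂ} {f : ℂ → ℂ}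
    {U : Set ℂ} (hU : IsOpen U) (hf : TendstoLocallyUniformlyOn F f φ U)
    (hF : ∀ i, DifferentiableOn ℂ (F i) U) (n : ℕ) :
    TendstoLocallyUniformlyOn (fun i => iteratedDeriv n (F i)) (iteratedDeriv n f) φ U ∧
      ∀ i, DifferentiableOn ℂ (iteratedDeriv n (F i)) U := by
  induction n with
  | zero => simpa using ⟨hf, hF⟩
  | succ n ih =>
    simp only [iteratedDeriv_succ]
    exact ⟨ih.1.deriv (Eventually.of_forall ih.2) hU, fun i => (ih.2 i).deriv hU⟩

lemma Polynomial.iteratedDeriv_eval_zero (P : Polynomial ℂ) (n : ℕ) :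
    iteratedDeriv n (fun z => P.eval z) 0 = n.factorial * P.coeff n := by
  have h : iteratedDeriv n (fun z => P.eval z) = fun z => (derivative^[n] P).eval z := by
    induction n with
    | zero => simp
    | succ n ih =>
      rw [iteratedDeriv_succ, ih, Function.iterate_succ_apply']
      ext z
      exact Polynomial.deriv _
  rw [h]
  simp [← Polynomial.coeff_zero_eq_eval_zero, Polynomial.coeff_iterate_derivative,
    Nat.descFactorial_self]

-- The analytic and the formal Euler product are matched coefficient by coefficient: Taylor
-- coefficients at 0 of the partial products converge to those of the analytic product, while as
-- formal coefficients they are eventually constant.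
open scoped PowerSeries.WithPiTopology in
lemma hasValue_pentagonalSeries {q : ℂ} (hq : ‖q‖ < 1) :
    HasValue (PowerSeries.pentagonalSeries ℤ) q (∏' n : ℕ, (1 - q ^ (n + 1))) := by
  have h1 := ModularForm.multipliableLocallyUniformlyOn_one_sub_pow.hasProdLocallyUniformlyOn
  have hd := ModularForm.differentiableOn_tprod_one_sub_pow
  have h2 := Complex.hasSum_taylorSeries_on_ball hd (z := q) (by simpa using hq)
  rw [HasValue]
  refine (congrArg (HasSum · _) (funext fun n => ?_)).mpr h2
  have h3 := ((tendstoLocallyUniformlyOn_iteratedDeriv Metric.isOpen_ball h1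
    (fun s => DifferentiableOn.fun_finsetProd (fun _ _ ↦ by fun_prop)) n).1.tendsto_at
      (Metric.mem_ball_self one_pos))
  have h4 : ∀ s : Finset ℕ, iteratedDeriv n (fun z : ℂ => ∏ i ∈ s, (1 - z ^ (i + 1))) 0 =
      n.factorial * ((PowerSeries.coeff n (∏ i ∈ s, (1 - (PowerSeries.X : PowerSeries ℤ) ^ (i + 1)))
        : ℤ) : ℂ) := by
    intro s
    let P : Polynomial ℤ := ∏ i ∈ s, (1 - Polynomial.X ^ (i + 1))
    have e1 : (fun z : ℂ => ∏ i ∈ s, (1 - z ^ (i + 1))) =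
        fun z => (P.map (Int.castRingHom ℂ)).eval z := by
      ext z
      simp [P, Polynomial.map_prod, Polynomial.eval_prod]
    have e2 : (∏ i ∈ s, (1 - (PowerSeries.X : PowerSeries ℤ) ^ (i + 1))) = (P : PowerSeries ℤ) := by
      rw [← Polynomial.coeToPowerSeries.ringHom_apply]
      simp [P, map_prod]
    rw [e1, Polynomial.iteratedDeriv_eval_zero, e2]
    simp
  simp only [h4] at h3
  have h5 := (PowerSeries.coeff_prod_one_sub_X_pow_eventually_eq ℤ n)
  have h6 := tendsto_nhds_unique h3 (tendsto_nhds_of_eventually_eq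
    (h5.mono fun s hs => by rw [hs]))
  rw [h6]
  have := Nat.cast_ne_zero (R := ℂ).mpr n.factorial_ne_zero
  simp
  field_simp

open scoped PowerSeries.WithPiTopology in
lemma ramanujanSeries_eq :
    ramanujanSeries = PowerSeries.X * PowerSeries.pentagonalSeries ℤ ^ 24 := by
  rw [ramanujanSeries, ← PowerSeries.WithPiTopology.tprod_one_sub_X_pow ℤ,
    (PowerSeries.WithPiTopology.multipliable_one_sub_X_pow ℤ).tprod_pow]

open ModularForm in
/-- The `q`-expansion of the discriminant form. -/
lemma hasSum_ramanujanTau_discriminant (z : UpperHalfPlane) :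
    HasSum (fun n => (ramanujanTau n : ℂ) * Function.Periodic.qParam 1 z ^ n) (discriminant z) := by
  have hq : ‖Function.Periodic.qParam 1 (z : ℂ)‖ < 1 :=
    Function.Periodic.norm_qParam_lt_one one_pos z.im_pos
  have := (hasValue_X (Function.Periodic.qParam 1 z)).mul ((hasValue_pentagonalSeries hq).pow 24)
  rw [← ramanujanSeries_eq, ← (multipliable_one_sub_pow hq).tprod_pow] at this
  rw [discriminant_eq_q_prod]
  exact this

end QExpansion

/-! ### The Hecke operator applied to the discriminant form -/

section HeckeOperator

open UpperHalfPlane ModularForm MatrixGroups Matrix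

lemma mapGL_mk_val {a b c d : ℤ} (h : (!![a, b; c, d] : Matrix (Fin 2) (Fin 2) ℤ).det = 1) :
    (SpecialLinearGroup.mapGL ℝ (⟨!![a, b; c, d], h⟩ : SL(2, ℤ))).val =
      !![(a : ℝ), (b : ℝ); (c : ℝ), (d : ℝ)] := by
  ext i j
  fin_cases i <;> fin_cases j <;> rfl

/-- The matrix `(1 b; 0 q)`. -/
noncomputable def heckeMatrix (q : ℕ) [NeZero q] (b : ℤ) : GL (Fin 2) ℝ :=
  GeneralLinearGroup.mkOfDetNeZero !![1, (b : ℝ); 0, (q : ℝ)] (by simp [NeZero.ne])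

/-- The matrix `(q 0; 0 1)`. -/
noncomputable def heckeMatrixInfty (q : ℕ) [NeZero q] : GL (Fin 2) ℝ :=
  GeneralLinearGroup.mkOfDetNeZero !![(q : ℝ), 0; 0, 1] (by simp [NeZero.ne])

lemma discriminant_slash (γ : SL(2, ℤ)) :
    discriminant ∣[(12 : ℤ)] SpecialLinearGroup.mapGL ℝ γ = discriminant :=
  SlashInvariantForm.slash_action_generators_SL2Z discriminant_S_invariant
    discriminant_T_invariant γ

/-- Since `Δ` is invariant under `SL(2, ℤ)`, slashing it by a matrix depends only on the left coset;
the action of `T` and `S` on the Hecke representatives thus reduces to explicit matrix identities.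
-/
lemma discriminant_slash_of_mul_eq {A B : GL (Fin 2) ℝ} (g : SL(2, ℤ)) {a b c d : ℤ}
    (h : a * d - b * c = 1)
    (hAB : A.val * (SpecialLinearGroup.mapGL ℝ g).val =
      !![(a : ℝ), (b : ℝ); (c : ℝ), (d : ℝ)] * B.val) :
    (discriminant ∣[(12 : ℤ)] A) ∣[(12 : ℤ)] g = discriminant ∣[(12 : ℤ)] B := by
  have hdet : (!![a, b; c, d] : Matrix (Fin 2) (Fin 2) ℤ).det = 1 := by
    rw [Matrix.det_fin_two_of, h]
  let γ : SL(2, ℤ) := ⟨_, hdet⟩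
  have h' : A * SpecialLinearGroup.mapGL ℝ g = SpecialLinearGroup.mapGL ℝ γ * B :=
    Units.ext (by rw [Units.val_mul, Units.val_mul, hAB, mapGL_mk_val hdet])
  change (discriminant ∣[(12 : ℤ)] A) ∣[(12 : ℤ)] (SpecialLinearGroup.mapGL ℝ g) = _
  rw [← SlashAction.slash_mul, h', SlashAction.slash_mul, discriminant_slash]

lemma mapGL_T_val : (SpecialLinearGroup.mapGL ℝ ModularGroup.T).val = !![(1 : ℝ), 1; 0, 1] :=
  (mapGL_mk_val ModularGroup.T.2).trans (by simp)

lemma mapGL_S_val : (SpecialLinearGroup.mapGL ℝ ModularGroup.S).val = !![(0 : ℝ), -1; 1, 0] :=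
  (mapGL_mk_val ModularGroup.S.2).trans (by simp)

variable (q : ℕ) [NeZero q]

lemma heckeMatrix_val (b : ℤ) : (heckeMatrix q b).val = !![1, (b : ℝ); 0, (q : ℝ)] := rfl

lemma heckeMatrixInfty_val : (heckeMatrixInfty q).val = !![(q : ℝ), 0; 0, 1] := rfl

lemma slash_heckeMatrix_T (b : ℤ) :
    (discriminant ∣[(12 : ℤ)] heckeMatrix q b) ∣[(12 : ℤ)] ModularGroup.T =
      discriminant ∣[(12 : ℤ)] heckeMatrix q (b + 1) := by
  refine discriminant_slash_of_mul_eq _ (a := 1) (b := 0) (c := 0) (d := 1) (by simp) ?_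
  rw [heckeMatrix_val, heckeMatrix_val, mapGL_T_val]
  simp [add_comm]

lemma slash_heckeMatrix_add_mul (b k : ℤ) :
    discriminant ∣[(12 : ℤ)] heckeMatrix q (b + k * q) =
      discriminant ∣[(12 : ℤ)] heckeMatrix q b := by
  have := discriminant_slash_of_mul_eq (A := heckeMatrix q (b + k * q))
    (B := heckeMatrix q b) 1 (a := 1) (b := k) (c := 0) (d := 1) (by simp) ?_
  · simpa [SL_slash] using this
  rw [heckeMatrix_val, heckeMatrix_val]
  simp

lemma slash_heckeMatrix_S {b c : ℤ} (h : (q : ℤ) ∣ b * c + 1) :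
    (discriminant ∣[(12 : ℤ)] heckeMatrix q b) ∣[(12 : ℤ)] ModularGroup.S =
      discriminant ∣[(12 : ℤ)] heckeMatrix q c := by
  obtain ⟨d, hd⟩ := h
  refine discriminant_slash_of_mul_eq _ (a := b) (b := -d) (c := q) (d := -c) ?_ ?_
  · linear_combination -hd
  · have hd' : (b : ℝ) * c + 1 = q * d := by exact_mod_cast hd
    rw [heckeMatrix_val, heckeMatrix_val, mapGL_S_val]
    simp
    constructor
    · linear_combination -hd'
    · ring

lemma slash_heckeMatrix_zero_S :
    (discriminant ∣[(12 : ℤ)] heckeMatrix q 0) ∣[(12 : ℤ)] ModularGroup.S =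
      discriminant ∣[(12 : ℤ)] heckeMatrixInfty q := by
  refine discriminant_slash_of_mul_eq _ (a := 0) (b := -1) (c := 1) (d := 0) (by simp) ?_
  rw [heckeMatrix_val, heckeMatrixInfty_val, mapGL_S_val]
  simp

lemma slash_heckeMatrixInfty_S :
    (discriminant ∣[(12 : ℤ)] heckeMatrixInfty q) ∣[(12 : ℤ)] ModularGroup.S =
      discriminant ∣[(12 : ℤ)] heckeMatrix q 0 := by
  refine discriminant_slash_of_mul_eq _ (a := 0) (b := -1) (c := 1) (d := 0) (by simp) ?_
  rw [heckeMatrix_val, heckeMatrixInfty_val, mapGL_S_val]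
  simp

lemma slash_heckeMatrixInfty_T :
    (discriminant ∣[(12 : ℤ)] heckeMatrixInfty q) ∣[(12 : ℤ)] ModularGroup.T =
      discriminant ∣[(12 : ℤ)] heckeMatrixInfty q := by
  refine discriminant_slash_of_mul_eq _ (a := 1) (b := q) (c := 0) (d := 1) (by simp) ?_
  rw [heckeMatrixInfty_val, mapGL_T_val]
  simp

lemma slash_heckeMatrix_congr {b c : ℤ} (h : (b : ZMod q) = c) :
    discriminant ∣[(12 : ℤ)] heckeMatrix q b = discriminant ∣[(12 : ℤ)] heckeMatrix q c := by
  obtain ⟨k, hk⟩ := (ZMod.intCast_eq_intCast_iff_dvd_sub c b q).mp h.symm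
  rw [show b = c + k * q by linear_combination hk, slash_heckeMatrix_add_mul]

/-- The image of the discriminant form under the Hecke operator `T_q`. -/
noncomputable def heckeDiscriminant : ℍ → ℂ :=
  ∑ b : ZMod q, discriminant ∣[(12 : ℤ)] heckeMatrix q (b.val : ℤ) +
    discriminant ∣[(12 : ℤ)] heckeMatrixInfty q

lemma heckeDiscriminant_T :
    heckeDiscriminant q ∣[(12 : ℤ)] ModularGroup.T = heckeDiscriminant q := by
  rw [heckeDiscriminant, SlashAction.add_slash, SlashAction.sum_slash, slash_heckeMatrixInfty_T]
  congr 1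
  refine Fintype.sum_equiv (Equiv.addRight 1) _ _ fun b => ?_
  rw [slash_heckeMatrix_T]
  exact slash_heckeMatrix_congr q (by simp)

lemma heckeDiscriminant_S (hq : q.Prime) :
    heckeDiscriminant q ∣[(12 : ℤ)] ModularGroup.S = heckeDiscriminant q := by
  have : Fact q.Prime := ⟨hq⟩
  rw [heckeDiscriminant, SlashAction.add_slash, SlashAction.sum_slash, slash_heckeMatrixInfty_S]
  rw [← Finset.add_sum_erase _ _ (Finset.mem_univ (0 : ZMod q)),
    ← Finset.add_sum_erase _ (fun b : ZMod q => discriminant ∣[(12 : ℤ)] heckeMatrix q (b.val : ℤ))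
      (Finset.mem_univ (0 : ZMod q))]
  have h : ∑ b ∈ Finset.univ.erase (0 : ZMod q),
      (discriminant ∣[(12 : ℤ)] heckeMatrix q (b.val : ℤ)) ∣[(12 : ℤ)] ModularGroup.S =
      ∑ b ∈ Finset.univ.erase (0 : ZMod q), discriminant ∣[(12 : ℤ)] heckeMatrix q (b.val : ℤ) := by
    -- `S` acts on the representatives as `b ↦ -1/b` on the projective line over `ZMod q`; it swaps
    -- `0` and infinity and permutes the rest.
    refine Finset.sum_bij' (fun b _ => -b⁻¹) (fun b _ => -b⁻¹) ?_ ?_ ?_ ?_ ?_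
    · simp
    · simp
    · simp [inv_neg]
    · simp [inv_neg]
    · intro b hb
      refine slash_heckeMatrix_S q ((ZMod.intCast_zmod_eq_zero_iff_dvd _ q).mp ?_)
      have hb' : b ≠ 0 := by simpa using hb
      push_cast
      simp [hb']
  rw [h]
  simp only [ZMod.val_zero, Nat.cast_zero, slash_heckeMatrix_zero_S]
  abel

/-- The image of the discriminant form under the Hecke operator `T_q`, as a cusp form. -/
noncomputable def heckeCuspForm (hq : q.Prime) : CuspForm 𝒮ℒ 12 where
  toFun := heckeDiscriminant q
  slash_action_eq' A hA := by
    obtain ⟨A, rfl⟩ := hA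
    exact SlashInvariantForm.slash_action_generators_SL2Z (heckeDiscriminant_S q hq)
      (heckeDiscriminant_T q) A
  holo' := by
    have h (A : GL (Fin 2) ℝ) := CuspForm.discriminant.holo'.slash 12 A
    exact (MDifferentiable.sum fun b _ => h _).add (h _)
  zero_at_cusps' hc := by
    rw [Subgroup.IsArithmetic.isCusp_iff_isCusp_SL2Z] at hc
    rw [OnePoint.isZeroAt_iff_forall_SL2Z hc]
    intro γ _
    rw [SlashInvariantForm.slash_action_generators_SL2Z (heckeDiscriminant_S q hq)
      (heckeDiscriminant_T q)]
    -- By invariance only the cusp at infinity matters, and upper triangular matrices fix it.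
    have h (A : GL (Fin 2) ℝ) (hA : A 1 0 = 0) :=
      IsZeroAtImInfty.slash 12 hA discriminant_isZeroAtImInfty
    refine Filter.ZeroAtFilter.add ?_ (h _ (by simp [heckeMatrixInfty_val]))
    exact Submodule.sum_mem (Filter.zeroAtFilterSubmodule ℂ atImInfty)
      fun b _ => h _ (by simp [heckeMatrix_val])

end HeckeOperator

/-! ### Coefficients of the Hecke image and Mordell's relation -/

section HeckeRelation

open UpperHalfPlane ModularForm MatrixGroups Matrix

variable (q : ℕ) [NeZero q]

lemma hasSum_slash_heckeMatrixInfty (z : ℍ) :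
    HasSum (fun n : ℕ => (q : ℂ) ^ 11 * ramanujanTau n * Function.Periodic.qParam 1 z ^ (q * n))
      ((discriminant ∣[(12 : ℤ)] heckeMatrixInfty q) z) := by
  have h := (hasSum_ramanujanTau_discriminant (heckeMatrixInfty q • z)).mul_left ((q : ℂ) ^ 11)
  have hq : (0 : ℝ) < q := Nat.cast_pos.mpr (NeZero.pos q)
  have hdet : (heckeMatrixInfty q).det.val = q := by
    simp [heckeMatrixInfty_val]
  have hdet' : 0 < (heckeMatrixInfty q).det.val := by rwa [hdet]
  have hco : ((heckeMatrixInfty q • z : ℍ) : ℂ) = q * z := by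
    rw [UpperHalfPlane.coe_smul_of_det_pos hdet']
    simp [num, denom, heckeMatrixInfty_val]
  rw [slash_apply, σ, if_pos hdet', hdet, abs_of_pos hq]
  have hden : denom (heckeMatrixInfty q) z = 1 := by simp [denom, heckeMatrixInfty_val]
  rw [hden]
  have e : ∀ n : ℕ, (q : ℂ) ^ 11 * (ramanujanTau n *
      Function.Periodic.qParam 1 (heckeMatrixInfty q • z : ℍ) ^ n) =
      (q : ℂ) ^ 11 * ramanujanTau n * Function.Periodic.qParam 1 z ^ (q * n) := fun n => by
    rw [hco, pow_mul, ← mul_assoc]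
    congr 2
    simp only [Function.Periodic.qParam, ← Complex.exp_nat_mul]
    congr 1
    push_cast
    ring
  replace h := (congrArg (HasSum · _) (funext e)).mp h
  convert h using 1
  simp
  norm_cast
  ring

lemma hasSum_slash_heckeMatrix (b : ℕ) (z : ℍ) :
    HasSum (fun n : ℕ => (q : ℂ)⁻¹ * (ramanujanTau n *
      (Function.Periodic.qParam q z ^ n * ZMod.stdAddChar ((b : ZMod q) * (n : ZMod q)))))
      ((discriminant ∣[(12 : ℤ)] heckeMatrix q b) z) := by
  have h := (hasSum_ramanujanTau_discriminant (heckeMatrix q b • z)).mul_left ((q : ℂ)⁻¹)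
  have hq : (0 : ℝ) < q := Nat.cast_pos.mpr (NeZero.pos q)
  have hq' : (q : ℂ) ≠ 0 := Nat.cast_ne_zero.mpr (NeZero.ne q)
  have hdet : (heckeMatrix q b).det.val = q := by
    simp [heckeMatrix_val]
  have hdet' : 0 < (heckeMatrix q b).det.val := by rwa [hdet]
  have hco : ((heckeMatrix q b • z : ℍ) : ℂ) = (z + b) / q := by
    rw [UpperHalfPlane.coe_smul_of_det_pos hdet']
    simp [num, denom, heckeMatrix_val]
  rw [slash_apply, σ, if_pos hdet', hdet, abs_of_pos hq]
  have hden : denom (heckeMatrix q b) z = q := by simp [denom, heckeMatrix_val]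
  rw [hden]
  have e : ∀ n : ℕ, (q : ℂ)⁻¹ * (ramanujanTau n *
      Function.Periodic.qParam 1 (heckeMatrix q b • z : ℍ) ^ n) = (q : ℂ)⁻¹ * (ramanujanTau n *
      (Function.Periodic.qParam q z ^ n * ZMod.stdAddChar ((b : ZMod q) * (n : ZMod q)))) :=
      fun n => by
    have : ((b : ZMod q) * (n : ZMod q)) = ((b * n : ℤ) : ZMod q) := by push_cast; rfl
    rw [hco, this, ZMod.stdAddChar_coe]
    congr 2
    simp only [Function.Periodic.qParam, ← Complex.exp_nat_mul, ← Complex.exp_add]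
    congr 1
    push_cast
    field_simp
  replace h := (congrArg (HasSum · _) (funext e)).mp h
  convert h using 1
  simp
  field_simp

lemma hasSum_sum_slash_heckeMatrix (z : ℍ) :
    HasSum (fun n : ℕ => (ramanujanTau (q * n) : ℂ) * Function.Periodic.qParam 1 z ^ n)
      (∑ b : ZMod q, (discriminant ∣[(12 : ℤ)] heckeMatrix q (b.val : ℤ)) z) := by
  have h := hasSum_sum (s := Finset.univ) fun (b : ZMod q) _ => hasSum_slash_heckeMatrix q b.val z
  have hq' : (q : ℂ) ≠ 0 := Nat.cast_ne_zero.mpr (NeZero.ne q)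
  have e : ∀ n : ℕ, ∑ b : ZMod q, (q : ℂ)⁻¹ * (ramanujanTau n *
      (Function.Periodic.qParam q z ^ n * ZMod.stdAddChar ((b.val : ZMod q) * (n : ZMod q)))) =
      if q ∣ n then (ramanujanTau n : ℂ) * Function.Periodic.qParam q z ^ n else 0 := fun n => by
    simp only [← Finset.mul_sum, ZMod.natCast_val, ZMod.cast_id', id]
    -- Orthogonality of additive characters: only the `n` divisible by `q` survive the sum over `b`.
    rw [AddChar.sum_mulShift _ (ZMod.isPrimitive_stdAddChar q)]
    simp only [ZMod.natCast_eq_zero_iff, ZMod.card]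
    split_ifs <;> field_simp
    simp
  replace h := (congrArg (HasSum · _) (funext e)).mp h
  have hinj : Function.Injective (fun n : ℕ => q * n) :=
    fun a b h => Nat.eq_of_mul_eq_mul_left (NeZero.pos q) h
  rw [← hinj.hasSum_iff] at h
  · refine (congrArg (HasSum · _) (funext fun n => ?_)).mp h
    simp only [Function.comp_apply, dvd_mul_right, if_true, pow_mul]
    congr 2
    simp only [Function.Periodic.qParam, ← Complex.exp_nat_mul]
    congr 1
    push_cast
    field_simp
  · intro n hn
    rw [if_neg]
    rintro ⟨m, rfl⟩
    exact hn ⟨m, rfl⟩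

/-- The coefficient of `T_q Δ` at `n`. -/
noncomputable def heckeCoeff (q n : ℕ) : ℤ :=
  ramanujanTau (q * n) + if q ∣ n then (q : ℤ) ^ 11 * ramanujanTau (n / q) else 0

lemma hasSum_heckeDiscriminant (z : ℍ) :
    HasSum (fun n : ℕ => (heckeCoeff q n : ℂ) * Function.Periodic.qParam 1 z ^ n)
      (heckeDiscriminant q z) := by
  have h : HasSum (fun n : ℕ => if q ∣ n then
      (q : ℂ) ^ 11 * ramanujanTau (n / q) * Function.Periodic.qParam 1 z ^ n else 0)
      ((discriminant ∣[(12 : ℤ)] heckeMatrixInfty q) z) := by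
    have hinj : Function.Injective (fun n : ℕ => q * n) :=
      fun a b h => Nat.eq_of_mul_eq_mul_left (NeZero.pos q) h
    rw [← hinj.hasSum_iff]
    · refine (congrArg (HasSum · _) (funext fun n => ?_)).mp (hasSum_slash_heckeMatrixInfty q z)
      simp [Nat.mul_div_cancel_left n (NeZero.pos q)]
    · intro n hn
      rw [if_neg]
      rintro ⟨m, rfl⟩
      exact hn ⟨m, rfl⟩
  have h' := (hasSum_sum_slash_heckeMatrix q z).add h
  simp only [heckeDiscriminant, Pi.add_apply, Finset.sum_apply]
  refine (congrArg (HasSum · _) (funext fun n => ?_)).mp h'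
  rw [heckeCoeff]
  split_ifs <;> push_cast <;> ring

lemma ramanujanTau_one : ramanujanTau 1 = 1 := by
  rw [ramanujanTau, ramanujanSeries_eq]
  rw [← zero_add 1, PowerSeries.coeff_succ_X_mul, PowerSeries.coeff_zero_eq_constantCoeff_apply,
    map_pow, ← PowerSeries.coeff_zero_eq_constantCoeff_apply]
  have h := PowerSeries.coeff_pentagonalSeries_pentagonal ℤ 0
  rw [show pentagonal 0 = 0 from rfl] at h
  rw [h]
  simp

/-- A theorem of Mordell: the Hecke relation for the Ramanujan function. -/
theorem heckeCoeff_eq {q : ℕ} (hq : q.Prime) (n : ℕ) :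
    heckeCoeff q n = ramanujanTau q * ramanujanTau n := by
  have : NeZero q := ⟨hq.ne_zero⟩
  obtain ⟨c, hc⟩ := CuspForm.exists_smul_discriminant_of_weight_eq_twelve (heckeCuspForm q hq)
  have hc' : ∀ z : ℍ, heckeDiscriminant q z = c * discriminant z := fun z =>
    (DFunLike.congr_fun hc z).symm
  have h1 (m : ℕ) : (heckeCoeff q m : ℂ) = (qExpansion 1 (heckeCuspForm q hq)).coeff m :=
    ModularFormClass.qExpansion_coeff_unique (c := fun m => (heckeCoeff q m : ℂ))
      one_pos one_mem_strictPeriods_SL (fun z => hasSum_heckeDiscriminant q z) m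
  have h2 (m : ℕ) : c * ramanujanTau m = (qExpansion 1 (heckeCuspForm q hq)).coeff m := by
    refine ModularFormClass.qExpansion_coeff_unique (c := fun m => c * ramanujanTau m)
      one_pos one_mem_strictPeriods_SL (fun z => ?_) m
    have h := (hasSum_ramanujanTau_discriminant z).mul_left c
    change HasSum _ (heckeDiscriminant q z)
    rw [hc']
    simpa [mul_assoc] using h
  -- The eigenvalue is read off at `n = 1`, where `τ(1) = 1`.
  have h3 : c = ramanujanTau q := by
    have := (h2 1).trans (h1 1).symm
    simpa [heckeCoeff, ramanujanTau_one, hq.ne_one] using this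
  have := (h1 n).trans (h2 n).symm
  rw [h3] at this
  exact_mod_cast this

end HeckeRelation

/-! ### Values of τ at small arguments -/

section SmallValues

/-- This and the next lemmas compute the 24th power of the truncated Euler product modulo `x ^ 23`
along the chain 1, 2, 3, 6, 12, 24 of exponents. Each witness is the explicit quotient; the cube
shows Jacobi's coefficients `±(2k+1)`. -/
lemma dvd_euler_sq {R : Type*} [CommRing R] (x : R) :
    x ^ 23 ∣
      ((1 - x - x ^ 2 + x ^ 5 + x ^ 7 - x ^ 12 - x ^ 15 + x ^ 22) ^ 2) -
      (1 - 2 * x - x ^ 2 + 2 * x ^ 3 + x ^ 4 + 2 * x ^ 5 - 2 * x ^ 6 - 2 * x ^ 8 - 2 * x ^ 9 + x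
       ^ 10 + 2 * x ^ 13 + 3 * x ^ 14 - 2 * x ^ 15 + 2 * x ^ 16 - 2 * x ^ 19 - 2 * x ^ 20) :=
  ⟨-2 - x + 4 * x ^ 4 + 2 * x ^ 6 + x ^ 7 - 2 * x ^ 11 - 2 * x ^ 14 + x ^ 21, by ring⟩

lemma dvd_euler_cube {R : Type*} [CommRing R] (x : R) :
    x ^ 23 ∣
      ((1 - 2 * x - x ^ 2 + 2 * x ^ 3 + x ^ 4 + 2 * x ^ 5 - 2 * x ^ 6 - 2 * x ^ 8 - 2 * x ^ 9 +
       x ^ 10 + 2 * x ^ 13 + 3 * x ^ 14 - 2 * x ^ 15 + 2 * x ^ 16 - 2 * x ^ 19 - 2 * x ^ 20) *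
       (1 - x - x ^ 2 + x ^ 5 + x ^ 7 - x ^ 12 - x ^ 15 + x ^ 22)) -
      (1 - 3 * x + 5 * x ^ 3 - 7 * x ^ 6 + 9 * x ^ 10 - 11 * x ^ 15 + 13 * x ^ 21) :=
  ⟨2 - x - 3 * x ^ 2 - 4 * x ^ 3 + 2 * x ^ 4 - 6 * x ^ 5 - 3 * x ^ 6 - 2 * x ^ 8 + 3 * x ^ 9 +
    2 * x ^ 11 + 4 * x ^ 12 + 3 * x ^ 13 - 2 * x ^ 14 + 2 * x ^ 15 - 2 * x ^ 18 - 2 * x ^ 19,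
    by ring⟩

lemma dvd_euler_pow_six {R : Type*} [CommRing R] (x : R) :
    x ^ 23 ∣
      ((1 - 3 * x + 5 * x ^ 3 - 7 * x ^ 6 + 9 * x ^ 10 - 11 * x ^ 15 + 13 * x ^ 21) ^ 2) -
      (1 - 6 * x + 9 * x ^ 2 + 10 * x ^ 3 - 30 * x ^ 4 + 11 * x ^ 6 + 42 * x ^ 7 - 70 * x ^ 9 +
       18 * x ^ 10 - 54 * x ^ 11 + 49 * x ^ 12 + 90 * x ^ 13 - 22 * x ^ 15 - 60 * x ^ 16 - 110 *
       x ^ 18 + 81 * x ^ 20 + 180 * x ^ 21 - 78 * x ^ 22) :=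
  ⟨130 * x - 198 * x ^ 2 - 182 * x ^ 4 + 121 * x ^ 7 + 234 * x ^ 8 - 286 * x ^ 13 + 169 * x ^
    19, by ring⟩

lemma dvd_euler_pow_twelve {R : Type*} [CommRing R] (x : R) :
    x ^ 23 ∣
      ((1 - 6 * x + 9 * x ^ 2 + 10 * x ^ 3 - 30 * x ^ 4 + 11 * x ^ 6 + 42 * x ^ 7 - 70 * x ^ 9 +
       18 * x ^ 10 - 54 * x ^ 11 + 49 * x ^ 12 + 90 * x ^ 13 - 22 * x ^ 15 - 60 * x ^ 16 - 110 *
       x ^ 18 + 81 * x ^ 20 + 180 * x ^ 21 - 78 * x ^ 22) ^ 2) -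
      (1 - 12 * x + 54 * x ^ 2 - 88 * x ^ 3 - 99 * x ^ 4 + 540 * x ^ 5 - 418 * x ^ 6 - 648 * x ^
       7 + 594 * x ^ 8 + 836 * x ^ 9 + 1056 * x ^ 10 - 4104 * x ^ 11 - 209 * x ^ 12 + 4104 * x ^
       13 - 594 * x ^ 14 + 4256 * x ^ 15 - 6480 * x ^ 16 - 4752 * x ^ 17 - 298 * x ^ 18 + 5016 *
       x ^ 19 + 17226 * x ^ 20 - 12100 * x ^ 21 - 5346 * x ^ 22) :=
  ⟨-1296 - 9323 * x - 5172 * x ^ 2 + 14778 * x ^ 3 + 30488 * x ^ 4 - 396 * x ^ 5 - 16812 * x ^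
    6 - 32580 * x ^ 7 - 8508 * x ^ 8 - 10710 * x ^ 9 + 45484 * x ^ 10 + 37956 * x ^ 11 - 17604 *
    x ^ 12 - 5540 * x ^ 13 - 18168 * x ^ 14 - 8460 * x ^ 15 - 39600 * x ^ 16 + 23721 * x ^ 17 +
    29160 * x ^ 18 + 19764 * x ^ 19 - 28080 * x ^ 20 + 6084 * x ^ 21, by ring⟩

lemma dvd_euler_pow_twentyFour {R : Type*} [CommRing R] (x : R) :
    x ^ 23 ∣
      ((1 - 12 * x + 54 * x ^ 2 - 88 * x ^ 3 - 99 * x ^ 4 + 540 * x ^ 5 - 418 * x ^ 6 - 648 * x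
       ^ 7 + 594 * x ^ 8 + 836 * x ^ 9 + 1056 * x ^ 10 - 4104 * x ^ 11 - 209 * x ^ 12 + 4104 * x
       ^ 13 - 594 * x ^ 14 + 4256 * x ^ 15 - 6480 * x ^ 16 - 4752 * x ^ 17 - 298 * x ^ 18 + 5016
       * x ^ 19 + 17226 * x ^ 20 - 12100 * x ^ 21 - 5346 * x ^ 22) ^ 2) -
      (1 - 24 * x + 252 * x ^ 2 - 1472 * x ^ 3 + 4830 * x ^ 4 - 6048 * x ^ 5 - 16744 * x ^ 6 +
       84480 * x ^ 7 - 113643 * x ^ 8 - 115920 * x ^ 9 + 534612 * x ^ 10 - 370944 * x ^ 11 -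
       577738 * x ^ 12 + 401856 * x ^ 13 + 1217160 * x ^ 14 + 987136 * x ^ 15 - 6905934 * x ^ 16
       + 2727432 * x ^ 17 + 10661420 * x ^ 18 - 7109760 * x ^ 19 - 4219488 * x ^ 20 - 12830688 *
       x ^ 21 + 18643272 * x ^ 22) :=
  ⟨21291552 - 25512203 * x + 13802424 * x ^ 2 - 72738432 * x ^ 3 + 23974832 * x ^ 4 + 125371860
    * x ^ 5 - 21862368 * x ^ 6 - 44440340 * x ^ 7 - 229939776 * x ^ 8 + 123892308 * x ^ 9 +
    243419112 * x ^ 10 - 48406884 * x ^ 11 + 54947376 * x ^ 12 - 367476372 * x ^ 13 - 55394592 *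
    x ^ 14 + 199176120 * x ^ 15 + 230831216 * x ^ 16 + 178534092 * x ^ 17 - 470500272 * x ^ 18 -
    37770392 * x ^ 19 + 129373200 * x ^ 20 + 28579716 * x ^ 21, by ring⟩

lemma dvd_euler_pow {R : Type*} [CommRing R] (x : R) :
    x ^ 23 ∣
      (1 - x - x ^ 2 + x ^ 5 + x ^ 7 - x ^ 12 - x ^ 15 + x ^ 22) ^ 24 -
      (1 - 24 * x + 252 * x ^ 2 - 1472 * x ^ 3 + 4830 * x ^ 4 - 6048 * x ^ 5 - 16744 * x ^ 6 +
       84480 * x ^ 7 - 113643 * x ^ 8 - 115920 * x ^ 9 + 534612 * x ^ 10 - 370944 * x ^ 11 -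
       577738 * x ^ 12 + 401856 * x ^ 13 + 1217160 * x ^ 14 + 987136 * x ^ 15 - 6905934 * x ^ 16
       + 2727432 * x ^ 17 + 10661420 * x ^ 18 - 7109760 * x ^ 19 - 4219488 * x ^ 20 - 12830688 *
       x ^ 21 + 18643272 * x ^ 22) := by
  have h2 := (dvd_euler_sq x).mul_right (1 - x - x ^ 2 + x ^ 5 + x ^ 7 - x ^ 12 - x ^ 15 + x ^ 22)
  rw [sub_mul, ← pow_succ] at h2
  have h3 := dvd_add h2 (dvd_euler_cube x)
  rw [sub_add_sub_cancel] at h3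
  have h6 := dvd_add (h3.trans (sub_dvd_pow_sub_pow _ _ 2)) (dvd_euler_pow_six x)
  rw [sub_add_sub_cancel, ← pow_mul] at h6
  have h12 := dvd_add (h6.trans (sub_dvd_pow_sub_pow _ _ 2)) (dvd_euler_pow_twelve x)
  rw [sub_add_sub_cancel, ← pow_mul] at h12
  have h24 := dvd_add (h12.trans (sub_dvd_pow_sub_pow _ _ 2)) (dvd_euler_pow_twentyFour x)
  rwa [sub_add_sub_cancel, ← pow_mul] at h24

lemma coeff_pentagonalSeries_eq_zero_of_lt {n : ℕ} (h : n < 23)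
    (h' : n ∉ ({0, 1, 2, 5, 7, 12, 15, 22} : Finset ℕ)) :
    PowerSeries.coeff n (PowerSeries.pentagonalSeries ℤ) = 0 := by
  refine PowerSeries.coeff_pentagonalSeries_eq_zero ℤ ?_
  rintro ⟨k, rfl⟩
  have hk := two_mul_natCast_pentagonal k
  have h1 : k ≤ 4 := by nlinarith
  have h2 : -4 ≤ k := by nlinarith
  interval_cases k <;> simp [pentagonal] at h h'

open PowerSeries in
lemma X_pow_dvd_pentagonalSeries_sub :
    (X : PowerSeries ℤ) ^ 23 ∣ pentagonalSeries ℤ -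
      (1 - X - X ^ 2 + X ^ 5 + X ^ 7 - X ^ 12 - X ^ 15 + X ^ 22) := by
  rw [X_pow_dvd_iff]
  intro m hm
  have h0 := coeff_pentagonalSeries_pentagonal ℤ 0
  have h1 := coeff_pentagonalSeries_pentagonal ℤ 1
  have h2 := coeff_pentagonalSeries_pentagonal ℤ (-1)
  have h5 := coeff_pentagonalSeries_pentagonal ℤ 2
  have h7 := coeff_pentagonalSeries_pentagonal ℤ (-2)
  have h12 := coeff_pentagonalSeries_pentagonal ℤ 3
  have h15 := coeff_pentagonalSeries_pentagonal ℤ (-3)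
  have h22 := coeff_pentagonalSeries_pentagonal ℤ 4
  have hz := @coeff_pentagonalSeries_eq_zero_of_lt
  rw [show pentagonal 0 = 0 from rfl] at h0
  rw [show pentagonal 1 = 1 from rfl] at h1
  rw [show pentagonal (-1) = 2 from rfl] at h2
  rw [show pentagonal 2 = 5 from rfl] at h5
  rw [show pentagonal (-2) = 7 from rfl] at h7
  rw [show pentagonal 3 = 12 from rfl] at h12
  rw [show pentagonal (-3) = 15 from rfl] at h15
  rw [show pentagonal 4 = 22 from rfl] at h22
  by_cases hm' : m ∈ ({0, 1, 2, 5, 7, 12, 15, 22} : Finset ℕ)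
  · simp only [Finset.mem_insert, Finset.mem_singleton] at hm'
    rcases hm' with rfl | rfl | rfl | rfl | rfl | rfl | rfl | rfl <;>
      simp only [map_sub, map_add, *] <;>
      simp [coeff_X_pow, coeff_X, coeff_one, Int.negOnePow_def]
  · rw [map_sub, hz hm hm']
    simp only [Finset.mem_insert, Finset.mem_singleton, not_or] at hm'
    simp [coeff_X_pow, coeff_X, coeff_one, hm']

open Polynomial in
lemma ramanujanTau_succ_eq_coeff {n : ℕ} (hn : n < 23) :
    ramanujanTau (n + 1) = Polynomial.coeff
      (1 - 24 * X + 252 * X ^ 2 - 1472 * X ^ 3 + 4830 * X ^ 4 - 6048 * X ^ 5 - 16744 * X ^ 6 +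
       84480 * X ^ 7 - 113643 * X ^ 8 - 115920 * X ^ 9 + 534612 * X ^ 10 - 370944 * X ^ 11 -
       577738 * X ^ 12 + 401856 * X ^ 13 + 1217160 * X ^ 14 + 987136 * X ^ 15 - 6905934 * X ^ 16
       + 2727432 * X ^ 17 + 10661420 * X ^ 18 - 7109760 * X ^ 19 - 4219488 * X ^ 20 - 12830688 *
       X ^ 21 + 18643272 * X ^ 22 : Polynomial ℤ) n := by
  rw [ramanujanTau, ramanujanSeries_eq, PowerSeries.coeff_succ_X_mul, ← Polynomial.coeff_coe,
    ← Polynomial.coeToPowerSeries.ringHom_apply]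
  have h := dvd_add (X_pow_dvd_pentagonalSeries_sub.trans (sub_dvd_pow_sub_pow _ _ 24))
    (dvd_euler_pow (PowerSeries.X : PowerSeries ℤ))
  rw [sub_add_sub_cancel, PowerSeries.X_pow_dvd_iff] at h
  have := h n hn
  rw [map_sub, sub_eq_zero] at this
  rw [this]
  simp only [map_add, map_sub, map_mul, map_pow, map_ofNat, map_one,
    Polynomial.coeToPowerSeries.ringHom_apply, Polynomial.coe_X]

lemma ramanujanTau_2 : ramanujanTau 2 = -24 := by
  rw [ramanujanTau_succ_eq_coeff (n := 1) (by norm_num)]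
  simp [Polynomial.coeff_X_pow, Polynomial.coeff_X, Polynomial.coeff_one]

lemma ramanujanTau_3 : ramanujanTau 3 = 252 := by
  rw [ramanujanTau_succ_eq_coeff (n := 2) (by norm_num)]
  simp [Polynomial.coeff_X_pow, Polynomial.coeff_X, Polynomial.coeff_one]

lemma ramanujanTau_5 : ramanujanTau 5 = 4830 := by
  rw [ramanujanTau_succ_eq_coeff (n := 4) (by norm_num)]
  simp [Polynomial.coeff_X_pow, Polynomial.coeff_X, Polynomial.coeff_one]

lemma ramanujanTau_7 : ramanujanTau 7 = -16744 := by
  rw [ramanujanTau_succ_eq_coeff (n := 6) (by norm_num)]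
  simp [Polynomial.coeff_X_pow, Polynomial.coeff_X, Polynomial.coeff_one]

lemma ramanujanTau_11 : ramanujanTau 11 = 534612 := by
  rw [ramanujanTau_succ_eq_coeff (n := 10) (by norm_num)]
  simp [Polynomial.coeff_X_pow, Polynomial.coeff_X, Polynomial.coeff_one]

lemma ramanujanTau_23 : ramanujanTau 23 = 18643272 := by
  rw [ramanujanTau_succ_eq_coeff (n := 22) (by norm_num)]
  simp [Polynomial.coeff_X_pow, Polynomial.coeff_X, Polynomial.coeff_one]

end SmallValues

/-! ### Multiplicativity and the six-term relation -/

section Multiplicativity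

lemma ramanujanTau_prime_mul {q n : ℕ} (hq : q.Prime) (h : ¬ q ∣ n) :
    ramanujanTau (q * n) = ramanujanTau q * ramanujanTau n := by
  simpa [heckeCoeff, h] using heckeCoeff_eq hq n

lemma ramanujanTau_prime_mul_mul {q : ℕ} (hq : q.Prime) (n : ℕ) :
    ramanujanTau (q * (q * n)) =
      ramanujanTau q * ramanujanTau (q * n) - q ^ 11 * ramanujanTau n := by
  have := heckeCoeff_eq hq (q * n)
  rw [heckeCoeff, if_pos (dvd_mul_right q n), Nat.mul_div_cancel_left n hq.pos] at this
  linear_combination this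

lemma ramanujanTau_prime_sq {q : ℕ} (hq : q.Prime) :
    ramanujanTau (q ^ 2) = ramanujanTau q ^ 2 - q ^ 11 := by
  have := ramanujanTau_prime_mul_mul hq 1
  rw [mul_one, ramanujanTau_one] at this
  rw [sq, this]
  ring

lemma ramanujanTau_prime_pow_mul {q n : ℕ} (hq : q.Prime) (h : ¬ q ∣ n) (k : ℕ) :
    ramanujanTau (q ^ k * n) = ramanujanTau (q ^ k) * ramanujanTau n := by
  induction k using Nat.strong_induction_on with
  | _ k ih =>
    match k with
    | 0 => simp [ramanujanTau_one]
    | 1 => simpa using ramanujanTau_prime_mul hq h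
    | k + 2 =>
      have h1 := ramanujanTau_prime_mul_mul hq (q ^ k * n)
      have h2 := ramanujanTau_prime_mul_mul hq (q ^ k)
      rw [← mul_assoc q (q ^ k) n, ← pow_succ', ih k (by lia), ih (k + 1) (by lia), ← mul_assoc,
        ← pow_succ'] at h1
      rw [← pow_succ', ← pow_succ'] at h2
      rw [h1, h2]
      ring

/-- The Ramanujan function is multiplicative. -/
theorem ramanujanTau_mul_of_coprime {m n : ℕ} (h : m.Coprime n) :
    ramanujanTau (m * n) = ramanujanTau m * ramanujanTau n := by
  induction m using Nat.recOnPosPrimePosCoprime generalizing n with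
  | prime_pow q k hq hk =>
    refine ramanujanTau_prime_pow_mul hq (fun hd => ?_) k
    exact hq.ne_one (Nat.dvd_one.mp (h ▸ Nat.dvd_gcd (dvd_pow_self q hk.ne') hd))
  | zero =>
    rw [Nat.coprime_zero_left] at h
    simp [h, ramanujanTau_one]
  | one => simp [ramanujanTau_one]
  | coprime a b _ _ hab iha ihb =>
    have ha := h.coprime_mul_right
    have hb := h.coprime_mul_left
    rw [mul_assoc, iha (hab.mul_right ha), ihb hb, iha hab]
    ring

lemma ramanujanTau_four : ramanujanTau 4 = -1472 := by
  have := ramanujanTau_prime_sq Nat.prime_two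
  norm_num [ramanujanTau_2] at this
  exact this

lemma ramanujanTau_nine : ramanujanTau 9 = -113643 := by
  have := ramanujanTau_prime_sq Nat.prime_three
  norm_num [ramanujanTau_3] at this
  exact this

lemma ramanujanTau_12 : ramanujanTau 12 = -370944 := by
  rw [show 12 = 4 * 3 from rfl, ramanujanTau_mul_of_coprime (by norm_num), ramanujanTau_four,
    ramanujanTau_3]
  norm_num

/-- A six-term linear relation between values of the Ramanujan function. -/
lemma ramanujanTau_six_term_relation :
    ramanujanTau 12 + (ramanujanTau 27 + ramanujanTau 55 + ramanujanTau 69 + ramanujanTau 90 +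
      ramanujanTau 105) = 0 := by
  have h27 := ramanujanTau_prime_mul_mul Nat.prime_three 3
  norm_num [ramanujanTau_3, ramanujanTau_nine] at h27
  rw [ramanujanTau_12, h27, show 55 = 5 * 11 from rfl, show 69 = 3 * 23 from rfl,
    show 90 = 2 * (9 * 5) from rfl, show 105 = 3 * (5 * 7) from rfl]
  repeat rw [ramanujanTau_mul_of_coprime (by norm_num)]
  rw [ramanujanTau_2, ramanujanTau_3, ramanujanTau_5, ramanujanTau_7, ramanujanTau_11,
    ramanujanTau_23, ramanujanTau_nine]
  norm_num

end Multiplicativity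

/-! ### A sum-product theorem in finite fields -/

section SumProducts

open Finset
open scoped Pointwise

section SumProduct

variable {F : Type*} [Field F] [Fintype F] [DecidableEq F]

/-- A bound for the number of coincidences among the sums `a + ξ b`, summed over all `ξ`. -/
lemma sum_card_coincidences_le (A B : Finset F) :
    ∑ ξ : F, #{x ∈ (A ×ˢ B) ×ˢ (A ×ˢ B) | x.1.1 + ξ * x.1.2 = x.2.1 + ξ * x.2.2} ≤
      Fintype.card F * (#A * #B) + (#A * #B) ^ 2 := by
  simp_rw [card_filter]
  rw [sum_comm]
  -- Two equal pairs coincide for every `ξ`, two distinct pairs for at most one.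
  have h : ∀ x ∈ (A ×ˢ B) ×ˢ (A ×ˢ B),
      ∑ ξ : F, (if x.1.1 + ξ * x.1.2 = x.2.1 + ξ * x.2.2 then 1 else 0) ≤
        (if x.1 = x.2 then Fintype.card F else 0) + 1 := by
    rintro ⟨⟨a, b⟩, ⟨a', b'⟩⟩ -
    rw [← card_filter]
    by_cases hx : (a, b) = (a', b')
    · simp only [hx, if_true]
      exact (card_le_univ _).trans (Nat.le_succ _)
    · simp only [hx, if_false, zero_add]
      rw [card_le_one]
      intro ξ hξ η hη
      simp only [mem_filter, mem_univ, true_and] at hξ hη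
      have hb : b ≠ b' := by
        rintro rfl
        exact hx (by simpa using hξ)
      have : (ξ - η) * (b - b') = 0 := by linear_combination hξ - hη
      rcases mul_eq_zero.mp this with h | h
      · exact sub_eq_zero.mp h
      · exact absurd (sub_eq_zero.mp h) hb
  refine (sum_le_sum h).trans ?_
  rw [sum_add_distrib]
  refine add_le_add ?_ ?_
  · rw [sum_product]
    simp only [sum_ite_eq]
    rw [sum_ite_mem, inter_self, sum_const, card_product, smul_eq_mul, mul_comm]
  · simp [card_product, sq]

/-- If `#A * #B > #F`, then some dilate `ξ B` has a sumset with `A` of more than `#F / 2`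
elements. -/
lemma exists_card_image_add_mul {A B : Finset F} (h : Fintype.card F < #A * #B) :
    ∃ ξ : F, Fintype.card F < 2 * #((A ×ˢ B).image fun x => x.1 + ξ * x.2) := by
  by_contra! hcon
  set N := #A * #B with hN
  set p := Fintype.card F
  have hp : 0 < p := Fintype.card_pos
  have key : ∀ ξ : F, 2 * N ^ 2 ≤ p *
      -- Cauchy–Schwarz: a small image forces many coincidences. Summing over `ξ` gives `2N² ≤ pN +
      -- N²`, contradicting `p < N`.
      #{x ∈ (A ×ˢ B) ×ˢ (A ×ˢ B) | x.1.1 + ξ * x.1.2 = x.2.1 + ξ * x.2.2} := by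
    intro ξ
    let f : F × F → F := fun x => x.1 + ξ * x.2
    have h1 : N = ∑ s ∈ (A ×ˢ B).image f, #{x ∈ A ×ˢ B | f x = s} := by
      rw [hN, ← card_product]
      exact card_eq_sum_card_image f _
    have h2 : #{x ∈ (A ×ˢ B) ×ˢ (A ×ˢ B) | f x.1 = f x.2} =
        ∑ s ∈ (A ×ˢ B).image f, #{x ∈ A ×ˢ B | f x = s} ^ 2 := by
      rw [card_eq_sum_card_fiberwise (f := fun x => f x.1) (t := (A ×ˢ B).image f)]
      · refine sum_congr rfl fun s _ => ?_
        rw [sq, ← card_product]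
        congr 1
        ext x
        simp only [mem_filter, mem_product]
        grind
      · intro x hx
        simp only [coe_filter, mem_product, Set.mem_ofPred_eq] at hx
        simp only [coe_image, Set.mem_image, mem_coe, mem_product]
        exact ⟨x.1, hx.1.1, rfl⟩
    have h3 := sq_sum_le_card_mul_sum_sq (s := (A ×ˢ B).image f)
      (f := fun s => #{x ∈ A ×ˢ B | f x = s})
    rw [← h1, ← h2] at h3
    calc 2 * N ^ 2 ≤ 2 * #((A ×ˢ B).image f) * #{x ∈ (A ×ˢ B) ×ˢ (A ×ˢ B) | f x.1 = f x.2} := by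
          rw [mul_assoc]; exact Nat.mul_le_mul_left 2 h3
      _ ≤ _ := Nat.mul_le_mul_right _ (hcon ξ)
  have h4 := sum_le_sum fun ξ (_ : ξ ∈ (univ : Finset F)) => key ξ
  rw [sum_const, ← mul_sum, smul_eq_mul, card_univ] at h4
  have h5 := h4.trans (Nat.mul_le_mul_left p (sum_card_coincidences_le A B))
  have h6 := Nat.le_of_mul_le_mul_left h5 hp
  rw [← hN] at h6
  change p < N at h
  nlinarith

/-- If `#A * #B > #F`, every element of the field is a sum of four products minus a sum of four
products of an element of `A` by an element of `B`. -/
theorem exists_eq_sum_products {A B : Finset F} (h : Fintype.card F < #A * #B) (x : F) :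
    x ∈ (4 • (A * B) - 4 • (A * B) : Finset F) := by
  obtain ⟨ξ, hξ⟩ := exists_card_image_add_mul h
  set S := (A ×ˢ B).image fun x => x.1 + ξ * x.2 with hS
  -- A collision gives `ξ (b₂ - b₁) = a₁ - a₂`, so multiplying `a + ξ b` by `b₂ - b₁` eliminates `ξ`
  -- and leaves two products minus two products.
  obtain ⟨y, hy, z, hz, hyz, e⟩ := exists_ne_map_eq_of_card_lt_of_maps_to
    (s := A ×ˢ B) (t := univ) (by rwa [card_product]) (f := fun x => x.1 + ξ * x.2)
    (fun _ _ => mem_univ _)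
  obtain ⟨a₁, b₁⟩ := y
  obtain ⟨a₂, b₂⟩ := z
  simp only [mem_product] at hy hz e
  have hb : b₂ - b₁ ≠ 0 := by
    intro hb
    have hb' : b₂ = b₁ := sub_eq_zero.mp hb
    subst hb'
    exact hyz (by simpa using e)
  -- As `S` fills more than half of the field, it meets its reflection `x / (b₂ - b₁) - S`.
  have hsum : ∃ s ∈ S, ∃ t ∈ S, s + t = x / (b₂ - b₁) := by
    have hc : #(S.image fun s => x / (b₂ - b₁) - s) = #S :=
      card_image_of_injective _ sub_right_injective
    obtain ⟨s, hs⟩ := inter_nonempty_of_card_lt_card_add_card (subset_univ S)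
      (subset_univ (S.image fun s => x / (b₂ - b₁) - s)) (by rw [hc, card_univ]; lia)
    obtain ⟨hsS, hs'⟩ := Finset.mem_inter.mp hs
    obtain ⟨t, ht, rfl⟩ := mem_image.mp hs'
    exact ⟨_, hsS, t, ht, by ring⟩
  obtain ⟨s, hs, t, ht, hst⟩ := hsum
  rw [hS, mem_image] at hs ht
  obtain ⟨⟨a, b⟩, hab, rfl⟩ := hs
  obtain ⟨⟨a', b'⟩, hab', rfl⟩ := ht
  simp only [mem_product] at hab hab'
  have hx : x = (a * b₂ + a₁ * b + (a' * b₂ + a₁ * b')) -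
      (a * b₁ + a₂ * b + (a' * b₁ + a₂ * b')) := by
    rw [eq_div_iff hb] at hst
    rw [← hst]
    linear_combination (-b - b') * e
  rw [hx, show 4 = 1 + 1 + (1 + 1) from rfl]
  simp only [add_nsmul, one_nsmul]
  refine sub_mem_sub (add_mem_add (add_mem_add ?_ ?_) (add_mem_add ?_ ?_))
    (add_mem_add (add_mem_add ?_ ?_) (add_mem_add ?_ ?_)) <;> apply mul_mem_mul <;> tauto

end SumProduct

end SumProducts

/-! ### Many differences of values of τ -/

section DifferenceSets

open Finset
open scoped Pointwise

/-- The positive integers up to `x` all of whose prime factors lie in `Q`. -/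
def factoredUpTo (Q : Finset ℕ) (x : ℕ) : Set ℕ :=
  {m | m ≠ 0 ∧ m ≤ x ∧ m.primeFactors ⊆ Q}

lemma prime_mem_factoredUpTo {Q : Finset ℕ} {q y : ℕ} (hq : q.Prime) (hQ : q ∈ Q) (hy : q ≤ y) :
    q ∈ factoredUpTo Q (y ^ 2) :=
  ⟨hq.ne_zero, hy.trans (Nat.le_self_pow two_ne_zero y), by simpa [hq.primeFactors] using hQ⟩

lemma mul_mem_factoredUpTo {Q : Finset ℕ} {q r y : ℕ} (hq : q.Prime) (hr : r.Prime) (hqQ : q ∈ Q)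
    (hrQ : r ∈ Q) (hqy : q ≤ y) (hry : r ≤ y) : q * r ∈ factoredUpTo Q (y ^ 2) := by
  refine ⟨mul_ne_zero hq.ne_zero hr.ne_zero, sq y ▸ Nat.mul_le_mul hqy hry, ?_⟩
  rw [Nat.primeFactors_mul hq.ne_zero hr.ne_zero, hq.primeFactors, hr.primeFactors]
  simp [insert_subset_iff, hqQ, hrQ]

variable {p : ℕ} [Fact p.Prime]

lemma card_le_eleven_mul_card_image {Q : Finset ℕ} (hQp : ∀ q ∈ Q, q < p) :
    #Q ≤ 11 * #(Q.image fun q : ℕ => (q : ZMod p) ^ 11) := by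
  classical
  have h1 : #(Q.image fun q : ℕ => (q : ZMod p)) = #Q := by
    refine card_image_of_injOn fun a ha b hb hab => ?_
    have := (ZMod.natCast_eq_natCast_iff a b p).mp hab
    exact Nat.ModEq.eq_of_lt_of_lt this (hQp a ha) (hQp b hb)
  have h2 : (Q.image fun q : ℕ => (q : ZMod p) ^ 11) =
      (Q.image fun q : ℕ => (q : ZMod p)).image fun x => x ^ 11 := by
    rw [image_image]; rfl
  rw [← h1, h2]
  refine card_le_mul_card_image _ 11 fun b _ => ?_
  calc _ ≤ #(Polynomial.nthRoots 11 b).toFinset := by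
        refine card_le_card fun x hx => ?_
        rw [Multiset.mem_toFinset, Polynomial.mem_nthRoots (by norm_num)]
        exact (mem_filter.mp hx).2
    _ ≤ _ := (Multiset.toFinset_card_le _).trans (Polynomial.card_nthRoots 11 b)

/-- Given a set `Q` of primes, many residues are differences of two values of the Ramanujan
function at products of at most two primes of `Q`. -/
lemma exists_many_differences {Q : Finset ℕ} {y : ℕ} (hQ : ∀ q ∈ Q, q.Prime)
    (hQy : ∀ q ∈ Q, q ≤ y) (hQp : ∀ q ∈ Q, q < p) :
    ∃ A : Finset (ZMod p), #Q ≤ 22 * #A ∧ ∀ a ∈ A, ∃ m ∈ factoredUpTo Q (y ^ 2),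
      ∃ m' ∈ factoredUpTo Q (y ^ 2), a = (ramanujanTau m : ZMod p) - ramanujanTau m' := by
  classical
  obtain rfl | ⟨q₀, hq₀⟩ := Q.eq_empty_or_nonempty
  · exact ⟨∅, by simp⟩
  let f : ℕ → ZMod p := fun q => ramanujanTau q
  -- The primes whose value is shared by another prime of `Q`; on the remaining ones `f` is
  -- injective.
  set R := {q ∈ Q | ∃ r ∈ Q, r ≠ q ∧ f r = f q} with hR
  have hRQ : ∀ q ∈ R, q ∈ Q := fun q hq => (mem_filter.mp hq).1
  have hsplit : #Q ≤ #(Q.image f) + #R := by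
    have h1 : #(Q \ R) ≤ #(Q.image f) := by
      refine card_le_card_of_injOn f (fun q hq => ?_) fun a ha b hb hab => ?_
      · exact mem_coe.mpr (mem_image_of_mem f (mem_sdiff.mp (mem_coe.mp hq)).1)
      · by_contra hne
        obtain ⟨ha1, -⟩ := mem_sdiff.mp (mem_coe.mp ha)
        obtain ⟨hb1, hb2⟩ := mem_sdiff.mp (mem_coe.mp hb)
        exact hb2 (mem_filter.mpr ⟨hb1, a, ha1, hne, hab⟩)
    have h2 := card_sdiff_add_card_eq_card (filter_subset _ Q : R ⊆ Q)
    lia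
  by_cases hcase : #Q ≤ 2 * #(Q.image f)
  · refine ⟨(Q.image f).image (· - f q₀), ?_, ?_⟩
    · rw [card_image_of_injective _ sub_left_injective]
      lia
    · intro a ha
      simp only [image_image, mem_image, Function.comp_apply] at ha
      obtain ⟨q, hq, rfl⟩ := ha
      exact ⟨q, prime_mem_factoredUpTo (hQ q hq) hq (hQy q hq), q₀,
        prime_mem_factoredUpTo (hQ q₀ hq₀) hq₀ (hQy q₀ hq₀), rfl⟩
  -- Here `R` contains more than half of `Q`, and if `τ(r) = τ(q)` then `τ(qr) - τ(q²) = q¹¹`.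
  -- Eleventh powers are at most 11-to-1, whence `22 = 2 * 11`.
  · refine ⟨R.image fun q : ℕ => (q : ZMod p) ^ 11, ?_, ?_⟩
    · have := card_le_eleven_mul_card_image fun q hq => hQp q (hRQ q hq)
      lia
    · intro a ha
      obtain ⟨q, hq, rfl⟩ := mem_image.mp ha
      obtain ⟨hqQ, r, hrQ, hrq, hf⟩ := mem_filter.mp hq
      have hqp := hQ q hqQ
      have hrp := hQ r hrQ
      refine ⟨q * r, mul_mem_factoredUpTo hqp hrp hqQ hrQ (hQy q hqQ) (hQy r hrQ), q * q,
        mul_mem_factoredUpTo hqp hqp hqQ hqQ (hQy q hqQ) (hQy q hqQ), ?_⟩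
      rw [ramanujanTau_mul_of_coprime ((Nat.coprime_primes hqp hrp).mpr hrq.symm), ← sq,
        ramanujanTau_prime_sq hqp]
      push_cast
      have hf' : (ramanujanTau r : ZMod p) = ramanujanTau q := hf
      rw [hf']
      ring

lemma map_mem_nsmul {G : Type*} [AddCommMonoid G] (f : G →+ G) {K T : Set G} {k : ℕ}
    (h : ∀ a ∈ K, f a ∈ k • T) (n : ℕ) {s : G} (hs : s ∈ n • K) : f s ∈ (n * k) • T := by
  induction n generalizing s with
  | zero =>
    obtain rfl : s = 0 := by simpa using hs
    simp
  | succ n ih =>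
    rw [succ_nsmul] at hs
    obtain ⟨a, ha, b, hb, rfl⟩ := hs
    rw [map_add, add_mul, one_mul, add_nsmul]
    exact Set.add_mem_add (ih ha) (h b hb)

/-- The residues of the Ramanujan function at positive integers up to `x` coprime to `M`. -/
def coprimeTauResidues (p M x : ℕ) : Set (ZMod p) :=
  {a | ∃ n : ℕ, n ≠ 0 ∧ n ≤ x ∧ n.Coprime M ∧ (ramanujanTau n : ZMod p) = a}

/-- Disjoint prime supports make the two indices coprime, so the product is a single value of `τ`.
Coprimality to `M` is kept for the later multiplication by the indices of the six-term relation. -/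
lemma mul_mem_coprimeTauResidues {Q₁ Q₂ : Finset ℕ} (hd : Disjoint Q₁ Q₂) {M : ℕ}
    (hM : ∀ q ∈ Q₁ ∪ Q₂, q.Coprime M) {y m n : ℕ} (hm : m ∈ factoredUpTo Q₁ (y ^ 2))
    (hn : n ∈ factoredUpTo Q₂ (y ^ 2)) :
    (ramanujanTau m : ZMod p) * ramanujanTau n ∈ coprimeTauResidues p M (y ^ 4) := by
  obtain ⟨hm0, hmy, hmQ⟩ := hm
  obtain ⟨hn0, hny, hnQ⟩ := hn
  refine ⟨m * n, mul_ne_zero hm0 hn0, ?_, ?_, ?_⟩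
  · calc m * n ≤ y ^ 2 * y ^ 2 := Nat.mul_le_mul hmy hny
      _ = y ^ 4 := by ring
  · refine Nat.Coprime.mul_left ?_ ?_
    · refine Nat.coprime_of_dvd fun k hk hkm hkM => ?_
      have := hM k (mem_union_left _ (hmQ (Nat.mem_primeFactors.mpr ⟨hk, hkm, hm0⟩)))
      exact hk.ne_one (Nat.eq_one_of_dvd_coprimes this dvd_rfl hkM)
    · refine Nat.coprime_of_dvd fun k hk hkm hkM => ?_
      have := hM k (mem_union_right _ (hnQ (Nat.mem_primeFactors.mpr ⟨hk, hkm, hn0⟩)))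
      exact hk.ne_one (Nat.eq_one_of_dvd_coprimes this dvd_rfl hkM)
  · rw [ramanujanTau_mul_of_coprime ((Nat.disjoint_primeFactors hm0 hn0).mp
      (disjoint_of_subset_left hmQ (disjoint_of_subset_right hnQ hd)))]
    push_cast
    rfl

/-- Every residue is a sum of sixteen values of the Ramanujan function minus sixteen values. -/
lemma exists_eq_sub_sixteen {Q₁ Q₂ : Finset ℕ} (hd : Disjoint Q₁ Q₂) {M y : ℕ}
    (hM : ∀ q ∈ Q₁ ∪ Q₂, q.Coprime M) (hprime : ∀ q ∈ Q₁ ∪ Q₂, q.Prime)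
    (hy : ∀ q ∈ Q₁ ∪ Q₂, q ≤ y) (hp : ∀ q ∈ Q₁ ∪ Q₂, q < p)
    (hcard : 22 ^ 2 * p < #Q₁ * #Q₂) (x : ZMod p) :
    ∃ s ∈ 16 • coprimeTauResidues p M (y ^ 4), ∃ t ∈ 16 • coprimeTauResidues p M (y ^ 4),
      x = s - t := by
  classical
  set K := coprimeTauResidues p M (y ^ 4) with hK
  obtain ⟨A, hAcard, hA⟩ := exists_many_differences (p := p) (y := y)
    (fun q hq => hprime q (mem_union_left Q₂ hq)) (fun q hq => hy q (mem_union_left Q₂ hq))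
    fun q hq => hp q (mem_union_left Q₂ hq)
  obtain ⟨B, hBcard, hB⟩ := exists_many_differences (p := p) (y := y)
    (fun q hq => hprime q (mem_union_right Q₁ hq)) (fun q hq => hy q (mem_union_right Q₁ hq))
    fun q hq => hp q (mem_union_right Q₁ hq)
  have hAB : Fintype.card (ZMod p) < #A * #B := by
    rw [ZMod.card]
    have := hcard.trans_le (Nat.mul_le_mul hAcard hBcard)
    nlinarith
  -- Expand `(τ(m) - τ(m'))(τ(n) - τ(n'))`.
  have hprod : ((A * B : Finset (ZMod p)) : Set (ZMod p)) ⊆ 2 • K - 2 • K := by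
    intro z hz
    obtain ⟨a, ha, b, hb, rfl⟩ := mem_mul.mp (mem_coe.mp hz)
    obtain ⟨m, hm, m', hm', rfl⟩ := hA a ha
    obtain ⟨n, hn, n', hn', rfl⟩ := hB b hb
    have h : ∀ {m n}, m ∈ factoredUpTo Q₁ (y ^ 2) → n ∈ factoredUpTo Q₂ (y ^ 2) →
        (ramanujanTau m : ZMod p) * ramanujanTau n ∈ K :=
      fun hm hn => mul_mem_coprimeTauResidues hd hM hm hn
    rw [two_nsmul]
    exact ⟨_, Set.add_mem_add (h hm hn) (h hm' hn'), _, Set.add_mem_add (h hm hn') (h hm' hn),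
      by ring⟩
  have h4 : ∀ z ∈ (4 • (A * B) : Finset (ZMod p)), z ∈ 8 • K - 8 • K := by
    intro z hz
    have hz' : z ∈ 4 • ((A * B : Finset (ZMod p)) : Set (ZMod p)) := by
      rw [← coe_nsmul]
      exact mem_coe.mpr hz
    have := Set.nsmul_subset_nsmul_left (n := 4) hprod hz'
    rwa [nsmul_sub, ← mul_nsmul] at this
  obtain ⟨v, hv, w, hw, rfl⟩ := mem_sub.mp (exists_eq_sum_products hAB x)
  obtain ⟨v₁, hv₁, v₂, hv₂, rfl⟩ := h4 v hv
  obtain ⟨w₁, hw₁, w₂, hw₂, rfl⟩ := h4 w hw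
  rw [show 16 = 8 + 8 from rfl, add_nsmul]
  exact ⟨_, Set.add_mem_add hv₁ hw₂, _, Set.add_mem_add hv₂ hw₁, by ring⟩

end DifferenceSets

/-! ### Supply of primes and removal of the minus signs -/

section Main

open Filter Topology
open scoped Pointwise

/-- Makes the lower bound for `π(n)` explicit: `log 2 > 0.69`, and `log (n + 1) ≤ 2 √(n + 1) ≤ 0.19
n`. -/
lemma half_le_mul_log_two_sub_log {n : ℕ} (hn : 150 ≤ n) :
    (n : ℝ) / 2 ≤ n * Real.log 2 - Real.log (n + 1) := by
  have hn' : (150 : ℝ) ≤ n := by exact_mod_cast hn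
  have h1 : Real.log (n + 1) ≤ 2 * √(n + 1) := by
    have h := Real.log_le_self (Real.sqrt_nonneg ((n : ℝ) + 1))
    rw [Real.log_sqrt (by positivity)] at h
    linarith
  have h2 : √((n : ℝ) + 1) ≤ 0.095 * n := Real.sqrt_le_iff.mpr ⟨by positivity, by nlinarith⟩
  have := Real.log_two_gt_d9
  nlinarith

/-- There are many primes up to `100 √p log p`. -/
lemma eventually_exists_primes : ∀ᶠ p : ℕ in atTop, ∃ y : ℕ,
    (y : ℝ) ≤ 100 * √p * Real.log p ∧ y < p ∧ ∃ Q₁ Q₂ : Finset ℕ, Disjoint Q₁ Q₂ ∧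
      (∀ q ∈ Q₁ ∪ Q₂, q.Prime ∧ q ≤ y ∧ 23 < q) ∧ 22 ^ 2 * p < Q₁.card * Q₂.card := by
  have h1 : ∀ᶠ p : ℕ in atTop, Real.log p ≤ 200⁻¹ * √p := by
    have h := ((isLittleO_log_rpow_atTop (r := 1 / 2) (by norm_num)).bound
      (c := 200⁻¹) (by norm_num)).natCast_atTop
    filter_upwards [h] with p hp
    rw [← Real.sqrt_eq_rpow, Real.norm_of_nonneg (Real.sqrt_nonneg _)] at hp
    exact (Real.le_norm_self _).trans hp
  filter_upwards [h1, eventually_ge_atTop 100] with p hlog hp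
  have hp' : (100 : ℝ) ≤ p := by exact_mod_cast hp
  set s := √(p : ℝ) with hs
  have hss : s * s = p := Real.mul_self_sqrt (by positivity)
  have hs10 : 10 ≤ s := Real.le_sqrt_of_sq_le (by linarith)
  have hl : 2 ≤ Real.log p := by
    rw [Real.le_log_iff_exp_le (by positivity)]
    have := Real.exp_one_lt_d9
    have h2 : Real.exp 2 = Real.exp 1 * Real.exp 1 := by rw [← Real.exp_add]; norm_num
    nlinarith [Real.exp_pos 1]
  set y := ⌊100 * s * Real.log p⌋₊ with hy
  have hy1 : (y : ℝ) ≤ 100 * s * Real.log p := Nat.floor_le (by positivity)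
  have hy2 : 100 * s * Real.log p < y + 1 := Nat.lt_floor_add_one _
  -- From `log p ≤ √p / 200` one gets `y ≤ p / 2`.
  have hyp : y < p := by
    have : (y : ℝ) < p := by nlinarith
    exact_mod_cast this
  have hy150 : 150 ≤ y := by
    have : (150 : ℝ) ≤ y := by nlinarith
    exact_mod_cast this
  refine ⟨y, hy1, hyp, ?_⟩
  have hpi : 50 * s - 1 ≤ y.primeCounting := by
    refine le_trans ?_ (Chebyshev.pi_ge y)
    have hy0 : (150 : ℝ) ≤ y := by exact_mod_cast hy150
    have hly : Real.log y ≤ Real.log p := Real.log_le_log (by positivity) (by exact_mod_cast hyp.le)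
    have hly0 : 0 < Real.log y := Real.log_pos (by linarith)
    rw [le_div_iff₀ hly0]
    calc (50 * s - 1) * Real.log y ≤ (50 * s - 1) * Real.log p := by gcongr; nlinarith
      _ ≤ y / 2 := by nlinarith
      _ ≤ _ := half_le_mul_log_two_sub_log hy150
  set Q := (Nat.primesLE y).filter (23 < ·) with hQ
  -- The discarded primes lie in `range 24`; this crude count suffices, as each half still has at
  -- least `25 s - 13 > 22 s` elements.
  have hQcard : y.primeCounting ≤ Q.card + 24 := by
    rw [← Nat.primesLE_card_eq_primeCounting, hQ,
      ← Finset.card_filter_add_card_filter_not (s := Nat.primesLE y) (23 < ·)]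
    refine Nat.add_le_add_left ?_ _
    refine (Finset.card_le_card (t := Finset.range 24) fun q hq => ?_).trans_eq (by simp)
    have := (Finset.mem_filter.mp hq).2
    rw [Finset.mem_range]
    lia
  obtain ⟨Q₁, hQ₁, hc⟩ := Finset.exists_subset_card_eq (s := Q) (n := Q.card / 2)
    (Nat.div_le_self _ _)
  refine ⟨Q₁, Q \ Q₁, Finset.disjoint_sdiff, fun q hq => ?_, ?_⟩
  · rw [Finset.union_sdiff_of_subset hQ₁, hQ, Finset.mem_filter, Nat.mem_primesLE] at hq
    tauto
  · have h2 := Finset.card_sdiff_add_card_eq_card hQ₁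
    have hQ' : 50 * s - 25 ≤ (Q.card : ℝ) := by
      have : (y.primeCounting : ℝ) ≤ Q.card + 24 := by exact_mod_cast hQcard
      linarith
    have h3 : (Q.card : ℝ) ≤ 2 * Q₁.card + 1 := by exact_mod_cast (by lia)
    have h4 : (Q.card : ℝ) ≤ 2 * (Q \ Q₁).card + 1 := by exact_mod_cast (by lia)
    have h5 : 22 * s < Q₁.card := by linarith
    have h6 : 22 * s < (Q \ Q₁).card := by linarith
    have h7 : (22 : ℝ) ^ 2 * p < Q₁.card * (Q \ Q₁).card := by
      calc (22 : ℝ) ^ 2 * p = (22 * s) * (22 * s) := by rw [← hss]; ring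
        _ < _ := by gcongr
    exact_mod_cast h7

/-- The product of the primes dividing the indices of the six-term relation. -/
abbrev relationLevel : ℕ := 2 * 3 * 5 * 7 * 11 * 23

lemma coprime_relationLevel {q : ℕ} (hq : q.Prime) (h : 23 < q) : q.Coprime relationLevel := by
  have h' : ∀ r : ℕ, r.Prime → r ≤ 23 → q.Coprime r := fun r hr hrq =>
    (Nat.coprime_primes hq hr).mpr (by lia)
  simp only [relationLevel, Nat.coprime_mul_iff_right]
  refine ⟨⟨⟨⟨⟨?_, ?_⟩, ?_⟩, ?_⟩, ?_⟩, ?_⟩ <;> exact h' _ (by norm_num) (by norm_num)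

lemma mul_mem_tauResidues {p c k y : ℕ} {X : ℝ} (hc0 : 0 < c) (hc : c ≤ 105)
    (hcM : c.Coprime k) (hk : k ≠ 0) (hky : k ≤ y ^ 4)
    (hX : 105 * (y : ℝ) ^ 4 ≤ X) :
    (ramanujanTau c : ZMod p) * ramanujanTau k ∈ tauResidues p X := by
  refine ⟨c * k, Nat.mul_pos hc0 (Nat.pos_of_ne_zero hk), le_trans ?_ hX, ?_⟩
  · exact_mod_cast Nat.mul_le_mul hc hky
  · rw [ramanujanTau_mul_of_coprime hcM]
    push_cast
    rfl

lemma coprime_of_coprime_relationLevel {k : ℕ} (h : k.Coprime relationLevel) :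
    ∀ c ∈ ({12, 27, 55, 69, 90, 105} : Finset ℕ), c.Coprime k := by
  simp only [relationLevel, Nat.coprime_mul_iff_right] at h
  obtain ⟨⟨⟨⟨⟨h2, h3⟩, h5⟩, h7⟩, h11⟩, h23⟩ := h
  simp only [Finset.mem_insert, Finset.mem_singleton]
  rintro c (rfl | rfl | rfl | rfl | rfl | rfl) <;> rw [Nat.coprime_comm]
  · exact ((h2.mul_right h2).mul_right h3 : k.Coprime (2 * 2 * 3))
  · exact (h3.mul_right h3).mul_right h3
  · exact h5.mul_right h11
  · exact h3.mul_right h23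
  · exact ((h2.mul_right h3).mul_right h3).mul_right h5
  · exact (h3.mul_right h5).mul_right h7

lemma mem_nsmul_tauResidues {p y : ℕ} [Fact p.Prime] (hp : 370944 < p) {X : ℝ}
    (hX : 105 * (y : ℝ) ^ 4 ≤ X)
    (h : ∀ x : ZMod p, ∃ s ∈ 16 • coprimeTauResidues p relationLevel (y ^ 4),
      ∃ t ∈ 16 • coprimeTauResidues p relationLevel (y ^ 4), x = s - t) (x : ZMod p) :
    x ∈ 96 • tauResidues p X := by
  set u : ZMod p := ((ramanujanTau 12 : ℤ) : ZMod p) with hu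
  -- `|τ(12)| = 370944 < p`.
  have hu0 : u ≠ 0 := by
    intro h0
    rw [hu, ramanujanTau_12, ZMod.intCast_zmod_eq_zero_iff_dvd] at h0
    have := Int.le_of_dvd (by norm_num) ((Int.dvd_neg).mpr h0)
    lia
  obtain ⟨s, hs, t, ht, hst⟩ := h (x / u)
  have h1 : u * s ∈ (16 * 1) • tauResidues p X := by
    refine map_mem_nsmul (AddMonoidHom.mulLeft u) ?_ 16 hs
    rintro _ ⟨k, hk0, hky, hkM, rfl⟩
    rw [one_nsmul]
    exact mul_mem_tauResidues (by norm_num) (by norm_num)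
      (coprime_of_coprime_relationLevel hkM 12 (by simp)) hk0 hky hX
  -- By the six-term relation `-u` is a sum of five values of `τ`, so each of the sixteen negative
  -- terms costs five.
  have h2 : -u * t ∈ (16 * 5) • tauResidues p X := by
    refine map_mem_nsmul (AddMonoidHom.mulLeft (-u)) ?_ 16 ht
    rintro _ ⟨k, hk0, hky, hkM, rfl⟩
    have hc := coprime_of_coprime_relationLevel hkM
    have hmem : ∀ c ∈ ({12, 27, 55, 69, 90, 105} : Finset ℕ), 0 < c → c ≤ 105 →
        (ramanujanTau c : ZMod p) * ramanujanTau k ∈ tauResidues p X :=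
      fun c hcm h0 h105 => mul_mem_tauResidues h0 h105 (hc c hcm) hk0 hky hX
    have hrel : -u = ramanujanTau 27 + ramanujanTau 55 + ramanujanTau 69 + ramanujanTau 90 +
        ramanujanTau 105 := by
      have := congrArg (Int.cast : ℤ → ZMod p) ramanujanTau_six_term_relation
      push_cast at this
      linear_combination -this
    rw [AddMonoidHom.coe_mulLeft, hrel, show 5 = 1 + 1 + 1 + 1 + 1 from rfl]
    simp only [add_nsmul, one_nsmul, add_mul]
    refine Set.add_mem_add (Set.add_mem_add (Set.add_mem_add (Set.add_mem_add ?_ ?_) ?_) ?_) ?_ <;>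
      exact hmem _ (by simp) (by norm_num) (by norm_num)
  have h3 : x = u * s + -u * t := by
    rw [div_eq_iff hu0] at hst
    rw [hst]
    ring
  rw [h3, show 96 = 16 * 1 + 16 * 5 from rfl, add_nsmul]
  exact Set.add_mem_add h1 h2

/-- For large `p`, every residue modulo `p` is a sum of 96 values of the Ramanujan function. -/
theorem eventually_isAdditiveBasisWith_tauResidues : ∀ᶠ p : ℕ in atTop, p.Prime →
    IsAdditiveBasisWith
      (tauResidues p ((105 * 100 ^ 4) * (p : ℝ) ^ 2 * Real.log (p : ℝ) ^ 4)) 96 := by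
  filter_upwards [eventually_exists_primes, eventually_gt_atTop 370944] with p h hp hprime x
  have : Fact p.Prime := ⟨hprime⟩
  obtain ⟨y, hy, hyp, Q₁, Q₂, hd, hQ, hcard⟩ := h
  refine Set.mem_nsmul_iff_sum.mp (mem_nsmul_tauResidues hp (y := y) ?_ ?_ x)
  · calc 105 * (y : ℝ) ^ 4 ≤ 105 * (100 * √p * Real.log p) ^ 4 := by gcongr
      _ = 105 * 100 ^ 4 * (√(p : ℝ) ^ 2) ^ 2 * Real.log p ^ 4 := by ring
      _ = _ := by rw [Real.sq_sqrt (by positivity)]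
  · exact exists_eq_sub_sixteen hd (fun q hq => coprime_relationLevel (hQ q hq).1 (hQ q hq).2.2)
      (fun q hq => (hQ q hq).1) (fun q hq => (hQ q hq).2.1)
      (fun q hq => (hQ q hq).2.1.trans_lt hyp) hcard

end Main

theorem mainTheorem3 :
    ∃ C : ℝ, 0 < C ∧ ∃ p₀ : ℕ, ∀ p : ℕ, p.Prime → p₀ ≤ p →
      (∀ r : ℤ, ∃ n : Fin 96 → ℕ,
        (∀ i, 0 < n i ∧ (n i : ℝ) ≤ C * (p : ℝ) ^ 2 * Real.log (p : ℝ) ^ 4) ∧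
        ∑ i, ramanujanTau (n i) ≡ r [ZMOD (p : ℤ)]) ∧
      ∃ h : ℕ, h ≤ 96 ∧
        IsAdditiveBasisOfOrder (tauResidues p (C * (p : ℝ) ^ 2 * Real.log (p : ℝ) ^ 4)) h := by
  obtain ⟨p₀, hp₀⟩ := Filter.eventually_atTop.mp eventually_isAdditiveBasisWith_tauResidues
  refine ⟨105 * 100 ^ 4, by norm_num, p₀, fun p hp hpp => ⟨fun r => ?_, ?_⟩⟩
  · obtain ⟨a, ha, hsum⟩ := hp₀ p hpp hp (r : ZMod p)
    choose n hn0 hnX hna using ha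
    refine ⟨n, fun i => ⟨hn0 i, hnX i⟩, (ZMod.intCast_eq_intCast_iff _ _ p).mp ?_⟩
    push_cast
    rw [← hsum]
    exact Finset.sum_congr rfl fun i _ => hna i
  · have h96 : 96 ∈ {k : ℕ | 0 < k ∧ IsAdditiveBasisWith
        (tauResidues p (105 * 100 ^ 4 * (p : ℝ) ^ 2 * Real.log (p : ℝ) ^ 4)) k} :=
      ⟨by norm_num, hp₀ p hpp hp⟩
    exact ⟨_, Nat.sInf_le h96, Nat.sInf_mem ⟨96, h96⟩, fun k hk => Nat.sInf_le hk⟩
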